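/- Let $\mathcal X$ be any set, $n\in\mathbb N$, $(x_1,\dots,x_n)\in\mathcal X^n$, and $L\ge 0$. Let $\epsilon_1,\dots,\epsilon_n$ be independent Rademacher variables (uniformly distributed on $\{-1,1\}$) on a probability space. For a class $\mathcal F$ and random variables $Z_f$, $f\in\mathcal F$, the expectation of $\sup_{f\in\mathcal F}Z_f$ is understood in $[-\infty,\infty]$. (i) Let $\mathcal F$ be a class of functions $f:\mathcal X\to\ell_2$, let $h_1,\dots,h_n:\ell_2\to\mathbb R$ be Lipschitz with constant $L$, and let $(\epsilon_{ik})_{1\le i\le n,\ k\ge 1}$ be independent Rademacher variables on the same probability space. Write $f_k(x_i)$ for the $k$-th coordinate of $f(x_i)$. Then for every $f\in\mathcal F$ the partial sums $\sum_{i=1}^n\sum_{k=1}^{K}\epsilon_{ik}f_k(x_i)$ converge, as $K\to\infty$, almost surely and in $L_2$, to a random variable denoted by $\sum_{i,k}\epsilon_{ik}f_k(x_i)$, and $$\mathbb E\sup_{f\in\mathcal F}\sum_{i=1}^n\epsilon_i h_i(f(x_i))\ \le\ \sqrt2\,L\ \mathbb E\sup_{f\in\mathcal F}\sum_{i,k}\epsilon_{ik}f_k(x_i),$$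 whichever versions of the random variables $\sum_{i,k}\epsilon_{ik}f_k(x_i)$, $f\in\mathcal F$, are chosen (with the convention $0\cdot\infty=0$). (ii) Let $K\in\mathbb N$, let $\mathcal F$ be a class of functions $f:\mathcal X\to\mathbb R^K$, let $h_1,\dots,h_n:\mathbb R^K\to\mathbb R$ be Lipschitz with constant $L$ with respect to the Euclidean norm, and let $(\epsilon_{ik})_{1\le i\le n,\ 1\le k\le K}$ be independent Rademacher variables on the same probability space. Then $$\mathbb E\sup_{f\in\mathcal F}\sum_{i=1}^n\epsilon_i h_i(f(x_i))\ \le\ \sqrt2\,L\ \mathbb E\sup_{f\in\mathcal F}\sum_{i=1}^n\sum_{k=1}^K\epsilon_{ik}f_k(x_i).$$ Here, if $\mathcal F$ is uncountable and the supremum $Z$ on the right is not measurable, $\mathbb E Z$ means $\int Z^+-\int Z^-$, where the integral of a nonnegative function is the supremum of the integrals of the measurable nonnegative functions below it. -/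

import Mathlib

open MeasureTheory ProbabilityTheory Filter Topology
open scoped NNReal ENNReal

/-- The Hilbert space `ℓ₂` of square summable real sequences. -/
abbrev EllTwo : Type := lp (fun _ : ℕ => ℝ) 2

/-- The Rademacher law: the uniform distribution on `{-1, 1}`. -/
noncomputable def rademacherLaw : Measure ℝ :=
  (2⁻¹ : ℝ≥0∞) • Measure.dirac (1 : ℝ) + (2⁻¹ : ℝ≥0∞) • Measure.dirac (-1 : ℝ)

/-- `ε` is a family of independent Rademacher variables on the probability space `(Ω, P)`. -/
structure IsRademacherFamily {Ω ι : Type*} [MeasurableSpace Ω] (P : Measure Ω)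
    (ε : ι → Ω → ℝ) : Prop where
  hasLaw : ∀ i, HasLaw (ε i) rademacherLaw P
  indep : iIndepFun ε P

/-- The expectation of an extended real valued random variable, `E Z = E Z⁺ - E Z⁻`. It is the usual
expectation, with values in `(-∞, ∞]`, as soon as `E Z⁻ < ∞`; this is so for the supremum of any
nonempty family of integrable random variables. -/
noncomputable def extExpectation {Ω : Type*} [MeasurableSpace Ω] (P : Measure Ω)
    (Z : Ω → EReal) : EReal :=
  ((∫⁻ ω, (Z ω).toENNReal ∂P : ℝ≥0∞) : EReal) - ((∫⁻ ω, (-Z ω).toENNReal ∂P : ℝ≥0∞) : EReal)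

/-- `E sup_{t ∈ T} Z t`, the supremum being the pointwise one in `[-∞, ∞]`. -/
noncomputable def expectedSup {Ω τ : Type*} [MeasurableSpace Ω] (P : Measure Ω)
    (T : Set τ) (Z : τ → Ω → ℝ) : EReal :=
  extExpectation P (fun ω => ⨆ t ∈ T, ((Z t ω : ℝ) : EReal))

/-- The partial sum `∑_{i} ∑_{k < K} ε_{ik} f_k(x_i)` of the series `∑_{i,k} ε_{ik} f_k(x_i)`.
(As `|ε_{ik}| = 1` almost surely, the series need not converge absolutely.) -/
noncomputable def partialRademacherSum {Ω 𝒳 : Type*} {n : ℕ} (ε : Fin n × ℕ → Ω → ℝ)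
    (x : Fin n → 𝒳) (f : 𝒳 → EllTwo) (K : ℕ) (ω : Ω) : ℝ :=
  ∑ i : Fin n, ∑ k ∈ Finset.range K, ε (i, k) ω * f (x i) k

/-- `Y` is a version of the random variable `∑_{i,k} ε_{ik} f_k(x_i)`: almost surely, it is the
limit of the partial sums. -/
def IsRademacherSum {Ω 𝒳 : Type*} [MeasurableSpace Ω] (P : Measure Ω) {n : ℕ}
    (ε : Fin n × ℕ → Ω → ℝ) (x : Fin n → 𝒳) (f : 𝒳 → EllTwo) (Y : Ω → ℝ) : Prop :=
  ∀ᵐ ω ∂P, Tendsto (fun K => partialRademacherSum ε x f K ω) atTop (𝓝 (Y ω))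

open scoped BigOperators

/-! ### Poincaré, Khintchine and contraction inequalities on the discrete cube. -/

section Cube

/-! The signs `ε i` are replaced one at a time by rows of independent signs. Averaging a supremum
over one sign only involves two maximisers `s` and `t`, hence the increment `ψ s - ψ t`. The
Lipschitz condition bounds this by a Euclidean norm, and Khintchine's inequality
`sqrt_sum_sq_le_expect_abs` bounds the norm by `√2` times the mean of `|∑ k, ω k * (φ s k - φ t
k)|`. As `ω` and `-ω` have the same law, that mean is absorbed by the supremum on the right
(`expect_sup'_add_sign_le`). Induction on the number of signs gives `expect_sup'_sign_le`.

The constant `√2` comes from the Latała–Oleszkiewicz argument: the modulus of a Rademacher sum is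
even, and even functions satisfy a Poincaré inequality with a doubled constant.

Arbitrary classes reduce to finite ones because the left side depends on finitely many sign patterns
(`expectedSup_le_of_forall_finset`), while the right side dominates each finite subclass without any
measurability. For `ℓ₂`, the finite-dimensional inequality is applied to `h i` composed with a
truncation; both sides then converge, the right one because the Rademacher series converge in `L²`.
-/

theorem expect_intUnits (F : ℤˣ → ℝ) : 𝔼 u, F u = (F 1 + F (-1)) / 2 := by
  have h : (Finset.univ : Finset ℤˣ) = {1, -1} := by decide
  rw [Finset.expect_eq_sum_div_card, h, Finset.sum_pair (by decide)]
  simp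

theorem expect_fin_cons {α : Type*} [Fintype α] {m : ℕ} (F : (Fin (m + 1) → α) → ℝ) :
    𝔼 ω, F ω = 𝔼 a, 𝔼 ω : Fin m → α, F (Fin.cons a ω) := by
  rw [← Fintype.expect_equiv (Fin.consEquiv fun _ : Fin (m + 1) => α)
    (fun p => F (Fin.cons p.1 p.2)) F (fun _ => rfl)]
  rw [← Finset.univ_product_univ, Finset.expect_product]

theorem expect_cube_succ {m : ℕ} (F : (Fin (m + 1) → ℤˣ) → ℝ) :
    𝔼 ω, F ω =
      ((𝔼 ω : Fin m → ℤˣ, F (Fin.cons 1 ω)) + 𝔼 ω : Fin m → ℤˣ, F (Fin.cons (-1) ω)) / 2 := by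
  rw [expect_fin_cons, expect_intUnits]

theorem expect_cube_neg {ι : Type*} [Fintype ι] [DecidableEq ι] (F : (ι → ℤˣ) → ℝ) :
    𝔼 ω, F (-ω) = 𝔼 ω, F ω :=
  Fintype.expect_equiv (Equiv.neg _) _ _ fun _ => rfl

/-- Flipping one sign. -/
def flipSign {m : ℕ} (i : Fin m) (ω : Fin m → ℤˣ) : Fin m → ℤˣ := Function.update ω i (-ω i)

theorem flipSign_cons_zero {m : ℕ} (u : ℤˣ) (ω : Fin m → ℤˣ) :
    flipSign 0 (Fin.cons u ω : Fin (m + 1) → ℤˣ) = Fin.cons (-u) ω := by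
  simp [flipSign, Fin.update_cons_zero]

theorem flipSign_cons_succ {m : ℕ} (u : ℤˣ) (i : Fin m) (ω : Fin m → ℤˣ) :
    flipSign i.succ (Fin.cons u ω : Fin (m + 1) → ℤˣ) = Fin.cons u (flipSign i ω) := by
  simp [flipSign, Fin.cons_update]

/-- The Dirichlet form `∑ i, E f (f - f ∘ flip i)` of the discrete cube. -/
noncomputable def cubeForm {m : ℕ} (f : (Fin m → ℤˣ) → ℝ) : ℝ :=
  ∑ i, 𝔼 ω, f ω * (f ω - f (flipSign i ω))

/-- Flipping the zeroth coordinate exchanges the two slices, and `a * (a - b) + b * (b - a) = (a -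
b) ^ 2`; every other flip acts inside a slice. -/
theorem cubeForm_succ {m : ℕ} (f : (Fin (m + 1) → ℤˣ) → ℝ) :
    cubeForm f = (𝔼 ω : Fin m → ℤˣ, (f (Fin.cons 1 ω) - f (Fin.cons (-1) ω)) ^ 2) / 2 +
      (cubeForm (fun ω => f (Fin.cons 1 ω)) + cubeForm (fun ω => f (Fin.cons (-1) ω))) / 2 := by
  simp only [cubeForm]
  rw [Fin.sum_univ_succ]
  simp only [expect_cube_succ, flipSign_cons_zero, flipSign_cons_succ, neg_neg]
  congr 1
  · rw [← Finset.expect_add_distrib]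
    congr 1
    exact Finset.expect_congr rfl fun ω _ => by ring
  · rw [← Finset.sum_div, Finset.sum_add_distrib]

/-- The parallelogram law for a quadratic form; it separates the even and odd parts `g`, `d` in the
induction for even functions. -/
theorem cubeForm_add_sub {m : ℕ} (g d : (Fin m → ℤˣ) → ℝ) :
    cubeForm (fun ω => g ω + d ω) + cubeForm (fun ω => g ω - d ω) =
      2 * cubeForm g + 2 * cubeForm d := by
  simp only [cubeForm]
  rw [Finset.mul_sum, Finset.mul_sum, ← Finset.sum_add_distrib, ← Finset.sum_add_distrib]
  refine Finset.sum_congr rfl fun i _ => ?_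
  rw [Finset.mul_expect, Finset.mul_expect, ← Finset.expect_add_distrib,
    ← Finset.expect_add_distrib]
  exact Finset.expect_congr rfl fun ω _ => by ring

theorem sq_expect_le {ι : Type*} [Fintype ι] [Nonempty ι] (f : ι → ℝ) :
    (𝔼 i, f i) ^ 2 ≤ 𝔼 i, f i ^ 2 := by
  have h : 0 ≤ 𝔼 i, (f i - 𝔼 j, f j) ^ 2 := Finset.expect_nonneg fun i _ => sq_nonneg _
  have h2 : 𝔼 i, (f i - 𝔼 j, f j) ^ 2 = (𝔼 i, f i ^ 2) - (𝔼 i, f i) ^ 2 := by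
    set c := 𝔼 j, f j with hc
    have : ∀ i, (f i - c) ^ 2 = f i ^ 2 - (2 * c) * f i + c ^ 2 := fun i => by ring
    simp only [this, Finset.expect_add_distrib, Finset.expect_sub_distrib, ← Finset.mul_expect,
      ← hc, Fintype.expect_const]
    ring
  linarith

/-- The Poincaré inequality on the discrete cube. -/
theorem two_mul_variance_le_cubeForm : ∀ {m : ℕ} (f : (Fin m → ℤˣ) → ℝ),
    2 * ((𝔼 ω, f ω ^ 2) - (𝔼 ω, f ω) ^ 2) ≤ cubeForm f
  | 0, f => by simp [cubeForm, Finset.expect_eq_sum_div_card]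
  | m + 1, f => by
    have h1 := two_mul_variance_le_cubeForm (fun ω : Fin m → ℤˣ => f (Fin.cons 1 ω))
    have h2 := two_mul_variance_le_cubeForm (fun ω : Fin m → ℤˣ => f (Fin.cons (-1) ω))
    -- The variance is the mean of the two slice variances plus a quarter of the squared difference
    -- of the slice means; Jensen lets the zeroth flip pay for the latter.
    have h3 := sq_expect_le
      (fun ω : Fin m → ℤˣ => f (Fin.cons 1 ω) - f (Fin.cons (-1) ω))
    rw [Finset.expect_sub_distrib] at h3
    rw [cubeForm_succ, expect_cube_succ, expect_cube_succ]
    nlinarith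

/-- For even functions the constant in the Poincaré inequality improves by a factor of two, as
their first order Walsh coefficients vanish. -/
theorem four_mul_variance_le_cubeForm_of_even : ∀ {m : ℕ} (f : (Fin m → ℤˣ) → ℝ),
    (∀ ω, f (-ω) = f ω) → 4 * ((𝔼 ω, f ω ^ 2) - (𝔼 ω, f ω) ^ 2) ≤ cubeForm f
  | 0, f, _ => by simp [cubeForm, Finset.expect_eq_sum_div_card]
  | m + 1, f, hf => by
    set g : (Fin m → ℤˣ) → ℝ := fun ω => (f (Fin.cons 1 ω) + f (Fin.cons (-1) ω)) / 2 with hg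
    set d : (Fin m → ℤˣ) → ℝ := fun ω => (f (Fin.cons 1 ω) - f (Fin.cons (-1) ω)) / 2 with hd
    have hneg : ∀ (u : ℤˣ) (ω : Fin m → ℤˣ),
        f (Fin.cons u (-ω)) = f (Fin.cons (-u) ω) := by
      intro u ω
      rw [← hf]
      congr 1
      ext i
      refine Fin.cases ?_ (fun j => ?_) i <;> simp
    have h1 := four_mul_variance_le_cubeForm_of_even g fun ω => by
      simp only [hg, hneg, neg_neg]; ring
    have h2 := two_mul_variance_le_cubeForm d
    -- As `d` is odd its mean vanishes, so the ordinary Poincaré inequality for `d` bounds all of `2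
    -- * 𝔼 d ^ 2`; the zeroth flip contributes the same amount again.
    have hd0 : 𝔼 ω, d ω = 0 := by
      have h : 𝔼 ω, d (-ω) = 𝔼 ω, -d ω := Finset.expect_congr rfl fun ω _ => by
        simp only [hd, hneg, neg_neg]; ring
      rw [expect_cube_neg, Finset.expect_neg_distrib] at h
      linarith
    have hp : (fun ω => f (Fin.cons 1 ω)) = fun ω => g ω + d ω := by
      funext ω; simp only [hg, hd]; ring
    have hm : (fun ω => f (Fin.cons (-1) ω)) = fun ω => g ω - d ω := by
      funext ω; simp only [hg, hd]; ring
    have hp' := fun ω => congrFun hp ω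
    have hm' := fun ω => congrFun hm ω
    have h3 := cubeForm_add_sub g d
    rw [cubeForm_succ, expect_cube_succ, expect_cube_succ, hp, hm]
    simp only [hp', hm']
    have h4 : 𝔼 ω, (g ω + d ω - (g ω - d ω)) ^ 2 = 4 * 𝔼 ω, d ω ^ 2 := by
      rw [Finset.mul_expect]; exact Finset.expect_congr rfl fun ω _ => by ring
    have h5 : (𝔼 ω, (g ω + d ω) ^ 2) + 𝔼 ω, (g ω - d ω) ^ 2 =
        2 * (𝔼 ω, g ω ^ 2) + 2 * 𝔼 ω, d ω ^ 2 := by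
      rw [Finset.mul_expect, Finset.mul_expect, ← Finset.expect_add_distrib,
        ← Finset.expect_add_distrib]
      exact Finset.expect_congr rfl fun ω _ => by ring
    rw [h4, h5, Finset.expect_add_distrib, Finset.expect_sub_distrib, hd0]
    rw [hd0] at h2
    nlinarith

/-- The Rademacher sum `∑ k, ω k * a k` on the discrete cube. -/
noncomputable def signSum {m : ℕ} (a : Fin m → ℝ) (ω : Fin m → ℤˣ) : ℝ :=
  ∑ k, ((ω k : ℤ) : ℝ) * a k

theorem signSum_neg {m : ℕ} (a : Fin m → ℝ) (ω : Fin m → ℤˣ) :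
    signSum a (-ω) = -signSum a ω := by
  simp [signSum]

theorem signSum_flipSign {m : ℕ} (a : Fin m → ℝ) (i : Fin m) (ω : Fin m → ℤˣ) :
    signSum a (flipSign i ω) = signSum a ω - 2 * (((ω i : ℤ) : ℝ) * a i) := by
  have h : signSum a (flipSign i ω) - signSum a ω = -2 * (((ω i : ℤ) : ℝ) * a i) := by
    simp only [signSum, ← Finset.sum_sub_distrib]
    rw [Finset.sum_eq_single i]
    · simp [flipSign]; ring
    · intro k _ hk; simp [flipSign, hk]
    · simp
  linarith

theorem expect_signSum_sq : ∀ {m : ℕ} (a : Fin m → ℝ), 𝔼 ω, signSum a ω ^ 2 = ∑ k, a k ^ 2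
  | 0, a => by simp [signSum, Finset.expect_eq_sum_div_card]
  | m + 1, a => by
    have ih := expect_signSum_sq (fun k : Fin m => a k.succ)
    have h : ∀ (u : ℤˣ) (ω : Fin m → ℤˣ), signSum a (Fin.cons u ω) =
        ((u : ℤ) : ℝ) * a 0 + signSum (fun k => a k.succ) ω := fun u ω => by
      simp [signSum, Fin.sum_univ_succ]
    rw [expect_cube_succ, Fin.sum_univ_succ, ← ih, ← Finset.expect_add_distrib, Finset.expect_div,
      ← Fintype.expect_const (ι := Fin m → ℤˣ) (a 0 ^ 2), ← Finset.expect_add_distrib]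
    refine Finset.expect_congr rfl fun ω _ => ?_
    simp only [h]
    simp
    ring

/-- For `S = signSum a`, the sum of `S` over all flips of `ω` is `(m - 2) * S ω`. By the triangle
inequality the Dirichlet form of `|S|` is then at most `2 * 𝔼 S ^ 2`, and the Poincaré inequality
for the even function `|S|` finishes. -/
theorem expect_signSum_sq_le {m : ℕ} (a : Fin m → ℝ) :
    𝔼 ω, signSum a ω ^ 2 ≤ 2 * (𝔼 ω, |signSum a ω|) ^ 2 := by
  have h1 := four_mul_variance_le_cubeForm_of_even (fun ω => |signSum a ω|)
    fun ω => by rw [signSum_neg, abs_neg]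
  have h2 : cubeForm (fun ω => |signSum a ω|) ≤ 2 * 𝔼 ω, signSum a ω ^ 2 := by
    rw [cubeForm, ← Finset.expect_sum_comm, Finset.mul_expect]
    refine Finset.expect_le_expect fun ω _ => ?_
    rw [← Finset.mul_sum, Finset.sum_sub_distrib, Finset.sum_const, Finset.card_univ,
      Fintype.card_fin, nsmul_eq_mul]
    have h3 : |∑ i, signSum a (flipSign i ω)| ≤ ∑ i, |signSum a (flipSign i ω)| :=
      Finset.abs_sum_le_sum_abs _ _
    have h4 : ∑ i, signSum a (flipSign i ω) = (m - 2) * signSum a ω := by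
      simp only [signSum_flipSign, Finset.sum_sub_distrib, Finset.sum_const, Finset.card_univ,
        Fintype.card_fin, nsmul_eq_mul, ← Finset.mul_sum]
      rw [← signSum]; ring
    have h5 : ((m : ℝ) - 2) * |signSum a ω| ≤ |∑ i, signSum a (flipSign i ω)| := by
      rw [h4, abs_mul]
      exact mul_le_mul_of_nonneg_right (le_abs_self _) (abs_nonneg _)
    rw [← sq_abs]
    nlinarith [abs_nonneg (signSum a ω)]
  simp only [sq_abs] at h1
  linarith

/-- The Khintchine inequality in `L¹` with Szarek's optimal constant. -/
theorem sqrt_sum_sq_le_expect_abs {m : ℕ} (a : Fin m → ℝ) :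
    √(∑ k, a k ^ 2) ≤ √2 * 𝔼 ω, |signSum a ω| := by
  rw [← expect_signSum_sq]
  have h0 : 0 ≤ 𝔼 ω, |signSum a ω| := Finset.expect_nonneg fun ω _ => abs_nonneg _
  refine (Real.sqrt_le_sqrt (expect_signSum_sq_le a)).trans ?_
  rw [Real.sqrt_mul zero_le_two, Real.sqrt_sq h0]

theorem expect_sup'_add_sign_le {τ : Type*} {T : Finset τ} (hT : T.Nonempty) {m : ℕ}
    (g ψ : τ → ℝ) (φ : τ → Fin m → ℝ)
    (hψ : ∀ s ∈ T, ∀ t ∈ T, |ψ s - ψ t| ≤ √(∑ k, (φ s k - φ t k) ^ 2)) :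
    𝔼 u : ℤˣ, T.sup' hT (fun t => g t + ((u : ℤ) : ℝ) * ψ t) ≤
      𝔼 ω : Fin m → ℤˣ, T.sup' hT (fun t => g t + √2 * signSum (φ t) ω) := by
  set M : (Fin m → ℤˣ) → ℝ := fun ω => T.sup' hT (fun t => g t + √2 * signSum (φ t) ω) with hM
  obtain ⟨s, hs, hs'⟩ := T.exists_mem_eq_sup' hT fun t => g t + (((1 : ℤˣ) : ℤ) : ℝ) * ψ t
  obtain ⟨t, ht, ht'⟩ := T.exists_mem_eq_sup' hT fun t => g t + (((-1 : ℤˣ) : ℤ) : ℝ) * ψ t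
  have h1 : ψ s - ψ t ≤ √2 * 𝔼 ω, |signSum (φ s) ω - signSum (φ t) ω| := by
    refine (le_abs_self _).trans ((hψ s hs t ht).trans ((sqrt_sum_sq_le_expect_abs _).trans_eq ?_))
    congr 1
    refine Finset.expect_congr rfl fun ω _ => ?_
    simp only [signSum, ← Finset.sum_sub_distrib, mul_sub]
  have h2 : ∀ ω, g s + g t + √2 * |signSum (φ s) ω - signSum (φ t) ω| ≤ M ω + M (-ω) := by
    intro ω
    have key : ∀ ω, ∀ r ∈ T, g r + √2 * signSum (φ r) ω ≤ M ω := fun ω r hr =>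
      Finset.le_sup' (fun t => g t + √2 * signSum (φ t) ω) hr
    have a1 := key ω s hs
    have a2 := key (-ω) s hs
    have a3 := key ω t ht
    have a4 := key (-ω) t ht
    rw [signSum_neg] at a2 a4
    -- The sign of the difference decides which of `s`, `t` is tested at `ω` and which at `-ω`.
    rcases abs_cases (signSum (φ s) ω - signSum (φ t) ω) with h | h <;> rw [h.1] <;> linarith
  have h3 := Finset.expect_le_expect (s := Finset.univ) fun ω _ => h2 ω
  rw [Finset.expect_add_distrib, Finset.expect_add_distrib, Finset.expect_add_distrib,
    expect_cube_neg M, Fintype.expect_const,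
    Fintype.expect_const, ← Finset.mul_expect] at h3
  rw [expect_intUnits, hs', ht']
  push_cast at *
  linarith

/-- The vector contraction inequality for finite classes, on the discrete cube. -/
theorem expect_sup'_sign_le {τ : Type*} {T : Finset τ} (hT : T.Nonempty) {m : ℕ} :
    ∀ {n : ℕ} (g : τ → ℝ) (ψ : τ → Fin n → ℝ) (φ : τ → Fin n → Fin m → ℝ),
    (∀ i, ∀ s ∈ T, ∀ t ∈ T, |ψ s i - ψ t i| ≤ √(∑ k, (φ s i k - φ t i k) ^ 2)) →
    𝔼 ω : Fin n → ℤˣ, T.sup' hT (fun t => g t + signSum (ψ t) ω) ≤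
      𝔼 η : Fin n → Fin m → ℤˣ, T.sup' hT (fun t => g t + √2 * ∑ i, signSum (φ t i) (η i))
  | 0, g, ψ, φ, _ => by simp [signSum, Finset.expect_eq_sum_div_card]
  | n + 1, g, ψ, φ, h => by
    rw [expect_fin_cons, expect_fin_cons, Finset.expect_comm]
    -- The offset `g` serves the induction: it first holds the sum over the remaining signs, then
    -- the row `ζ` already exchanged.
    calc _ ≤ 𝔼 ω : Fin n → ℤˣ, 𝔼 ζ : Fin m → ℤˣ, T.sup' hT (fun t =>
            (g t + signSum (fun i => ψ t i.succ) ω) + √2 * signSum (φ t 0) ζ) := by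
          refine Finset.expect_le_expect fun ω _ => ?_
          refine le_trans (le_of_eq ?_) (expect_sup'_add_sign_le hT
            (fun t => g t + signSum (fun i => ψ t i.succ) ω) (fun t => ψ t 0) (fun t => φ t 0) (h 0))
          refine Finset.expect_congr rfl fun u _ => ?_
          congr 1
          funext t
          simp [signSum, Fin.sum_univ_succ]
          ring
      _ = 𝔼 ζ : Fin m → ℤˣ, 𝔼 ω : Fin n → ℤˣ, T.sup' hT (fun t =>
            (g t + √2 * signSum (φ t 0) ζ) + signSum (fun i => ψ t i.succ) ω) := by
          rw [Finset.expect_comm]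
          refine Finset.expect_congr rfl fun ζ _ => Finset.expect_congr rfl fun ω _ => ?_
          congr 1
          funext t
          ring
      _ ≤ _ := by
          refine Finset.expect_le_expect fun ζ _ => ?_
          refine (expect_sup'_sign_le hT _ _ (fun t i => φ t i.succ)
            fun i => h i.succ).trans_eq ?_
          refine Finset.expect_congr rfl fun η _ => ?_
          congr 1
          funext t
          simp [Fin.sum_univ_succ]
          ring

end Cube

/-! ### Transfer between Rademacher families and the discrete cube. -/

section Rademacher

variable {Ω ι : Type*} [MeasurableSpace Ω] {P : Measure Ω}

theorem rademacherLaw_apply {s : Set ℝ} (hs : MeasurableSet s) :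
    rademacherLaw s = ∑ u : ℤˣ, 2⁻¹ * s.indicator (1 : ℝ → ℝ≥0∞) ((u : ℤ) : ℝ) := by
  have h : (Finset.univ : Finset ℤˣ) = {1, -1} := by decide
  rw [h, Finset.sum_pair (by decide)]
  simp [rademacherLaw, Measure.dirac_apply' _ hs]

instance : IsProbabilityMeasure rademacherLaw :=
  ⟨by simp [rademacherLaw, ENNReal.inv_two_add_inv_two]⟩

theorem pi_rademacherLaw [Fintype ι] [DecidableEq ι] :
    Measure.pi (fun _ : ι => rademacherLaw) =
      ∑ ω : ι → ℤˣ, (2⁻¹ : ℝ≥0∞) ^ Fintype.card ι •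
        Measure.dirac (fun i => ((ω i : ℤ) : ℝ)) := by
  refine Measure.pi_eq fun s hs => ?_
  simp_rw [rademacherLaw_apply (hs _)]
  rw [Finset.prod_univ_sum, Fintype.piFinset_univ, Measure.finsetSum_apply]
  refine Finset.sum_congr rfl fun ω _ => ?_
  rw [Finset.prod_mul_distrib, Finset.prod_const, Finset.card_univ, Measure.smul_apply,
    Measure.dirac_apply' _ (MeasurableSet.univ_pi hs), smul_eq_mul]
  congr 1
  by_cases h : ∀ i, ((ω i : ℤ) : ℝ) ∈ s i
  · rw [Set.indicator_of_mem (by simpa using h)]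
    simp [h]
  · rw [Set.indicator_of_notMem (by simpa using h)]
    push Not at h
    obtain ⟨i, hi⟩ := h
    rw [Finset.prod_eq_zero (Finset.mem_univ i) (Set.indicator_of_notMem hi _)]

namespace IsRademacherFamily

theorem comp_injective {κ : Type*} {ε : ι → Ω → ℝ} (h : IsRademacherFamily P ε) {g : κ → ι}
    (hg : Function.Injective g) : IsRademacherFamily P fun k => ε (g k) :=
  ⟨fun k => h.hasLaw (g k), h.indep.precomp hg⟩

variable [Fintype ι] {ε : ι → Ω → ℝ}

theorem aemeasurable_fun (h : IsRademacherFamily P ε) :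
    AEMeasurable (fun ω i => ε i ω) P :=
  aemeasurable_pi_lambda _ fun i => (h.hasLaw i).aemeasurable

theorem map_fun_eq [DecidableEq ι] [IsProbabilityMeasure P] (h : IsRademacherFamily P ε) :
    P.map (fun ω i => ε i ω) = ∑ σ : ι → ℤˣ, (2⁻¹ : ℝ≥0∞) ^ Fintype.card ι •
        Measure.dirac (fun i => ((σ i : ℤ) : ℝ)) := by
  rw [(iIndepFun_iff_map_fun_eq_pi_map fun i => (h.hasLaw i).aemeasurable).1 h.indep,
    ← pi_rademacherLaw]
  congr 1
  funext i
  exact (h.hasLaw i).map_eq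

/-- The joint law is a finite sum of point masses, so `G` needs no measurability. -/
theorem integrable_map [IsProbabilityMeasure P] (h : IsRademacherFamily P ε) (G : (ι → ℝ) → ℝ) :
    Integrable G (P.map fun ω i => ε i ω) := by
  classical
  rw [h.map_fun_eq, integrable_finsetSum_measure]
  exact fun σ _ => (integrable_dirac (by simp)).smul_measure (by simp)

theorem integrable [IsProbabilityMeasure P] (h : IsRademacherFamily P ε) (G : (ι → ℝ) → ℝ) :
    Integrable (fun ω => G fun i => ε i ω) P :=
  (h.integrable_map G).comp_aemeasurable h.aemeasurable_fun

theorem integral_eq [DecidableEq ι] [IsProbabilityMeasure P] (h : IsRademacherFamily P ε) (G : (ι → ℝ) → ℝ) :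
    ∫ ω, G (fun i => ε i ω) ∂P = 𝔼 σ : ι → ℤˣ, G fun i => ((σ i : ℤ) : ℝ) := by
  rw [← integral_map h.aemeasurable_fun (h.integrable_map G).aestronglyMeasurable, h.map_fun_eq,
    integral_finsetSum_measure
      fun σ _ => (integrable_dirac (by simp)).smul_measure (by simp),
    Finset.expect_eq_sum_div_card, Finset.sum_div]
  refine Finset.sum_congr rfl fun σ _ => ?_
  rw [integral_smul_measure, integral_dirac, Finset.card_univ, Fintype.card_fun]
  simp [div_eq_inv_mul]

theorem ae_exists_sign (h : IsRademacherFamily P ε) :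
    ∀ᵐ ω ∂P, ∃ σ : ι → ℤˣ, ∀ i, ε i ω = ((σ i : ℤ) : ℝ) := by
  have : ∀ i, ∀ᵐ ω ∂P, ∃ u : ℤˣ, ε i ω = ((u : ℤ) : ℝ) := fun i => by
    refine ae_of_ae_map (p := fun y => ∃ u : ℤˣ, y = ((u : ℤ) : ℝ)) (h.hasLaw i).aemeasurable ?_
    rw [(h.hasLaw i).map_eq, rademacherLaw, ae_add_measure_iff]
    constructor
    · refine Measure.ae_smul_measure ?_ _
      rw [ae_dirac_eq]
      exact ⟨1, by simp⟩
    · refine Measure.ae_smul_measure ?_ _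
      rw [ae_dirac_eq]
      exact ⟨-1, by simp⟩
  filter_upwards [ae_all_iff.2 this] with ω hω
  choose σ hσ using hω
  exact ⟨σ, hσ⟩

end IsRademacherFamily

end Rademacher

/-! ### Expected suprema and reduction to finite classes. -/

section ExpectedSup

variable {Ω τ : Type*} [MeasurableSpace Ω] {P : Measure Ω}

/-- Holds for nonmeasurable functions because `∫⁻` is a lower integral, monotone for all functions.
-/
theorem extExpectation_mono {Z W : Ω → EReal} (h : ∀ ω, Z ω ≤ W ω) :
    extExpectation P Z ≤ extExpectation P W := by
  refine EReal.sub_le_sub ?_ ?_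
  · exact EReal.coe_ennreal_le_coe_ennreal_iff.2
      (lintegral_mono fun ω => EReal.toENNReal_le_toENNReal (h ω))
  · exact EReal.coe_ennreal_le_coe_ennreal_iff.2
      (lintegral_mono fun ω => EReal.toENNReal_le_toENNReal (EReal.neg_le_neg_iff.2 (h ω)))

theorem extExpectation_eq_coe_integral {Z : Ω → EReal} {Y : Ω → ℝ} (hY : Integrable Y P)
    (h : ∀ᵐ ω ∂P, Z ω = (Y ω : EReal)) : extExpectation P Z = ((∫ ω, Y ω ∂P : ℝ) : EReal) := by
  have h1 : ∫⁻ ω, (Z ω).toENNReal ∂P = ∫⁻ ω, ENNReal.ofReal (Y ω) ∂P :=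
    lintegral_congr_ae (by filter_upwards [h] with ω hω; rw [hω, EReal.toENNReal_of_ne_top
      (EReal.coe_ne_top _), EReal.toReal_coe])
  have h2 : ∫⁻ ω, (-Z ω).toENNReal ∂P = ∫⁻ ω, ENNReal.ofReal (-Y ω) ∂P :=
    lintegral_congr_ae (by filter_upwards [h] with ω hω; rw [hω, ← EReal.coe_neg,
      EReal.toENNReal_of_ne_top (EReal.coe_ne_top _), EReal.toReal_coe])
  have f1 : ∫⁻ ω, ENNReal.ofReal (Y ω) ∂P ≠ ∞ := hY.lintegral_lt_top.ne
  have f2 : ∫⁻ ω, ENNReal.ofReal (-Y ω) ∂P ≠ ∞ := hY.neg.lintegral_lt_top.ne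
  rw [extExpectation, h1, h2, integral_eq_lintegral_pos_part_sub_lintegral_neg_part hY,
    EReal.coe_sub, ← EReal.coe_ennreal_toReal f1, ← EReal.coe_ennreal_toReal f2]

theorem expectedSup_empty [IsProbabilityMeasure P] (Z : τ → Ω → ℝ) :
    expectedSup P ∅ Z = ⊥ := by
  simp [expectedSup, extExpectation]

/-- The supremum over a finite subset of `T` bounds `expectedSup` from below; no measurability of
the full supremum is needed. -/
theorem coe_integral_sup'_le_expectedSup {T : Set τ} {Z : τ → Ω → ℝ} {T₀ : Finset τ}
    (hT₀ : T₀.Nonempty) (hsub : ↑T₀ ⊆ T)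
    (hint : Integrable (fun ω => T₀.sup' hT₀ fun t => Z t ω) P) :
    ((∫ ω, T₀.sup' hT₀ (fun t => Z t ω) ∂P : ℝ) : EReal) ≤ expectedSup P T Z := by
  rw [← extExpectation_eq_coe_integral hint (ae_of_all _ fun ω => rfl)]
  refine extExpectation_mono fun ω => ?_
  obtain ⟨t, ht, h⟩ := T₀.exists_mem_eq_sup' hT₀ fun t => Z t ω
  rw [h]
  exact le_iSup₂ (f := fun t (_ : t ∈ T) => ((Z t ω : ℝ) : EReal)) t (hsub ht)

theorem integrable_sup' {T : Finset τ} (hT : T.Nonempty) {Z : τ → Ω → ℝ}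
    (hZ : ∀ t ∈ T, Integrable (Z t) P) : Integrable (fun ω => T.sup' hT fun t => Z t ω) P := by
  have : (fun ω => T.sup' hT fun t => Z t ω) = T.sup' hT Z := by
    funext ω; rw [Finset.sup'_apply]
  rw [this]
  exact Finset.sup'_induction hT Z (p := fun f => Integrable f P) (fun _ hf _ hg => hf.sup hg) hZ

/-- To bound the expected supremum of Rademacher sums, it suffices to do so for finite subclasses:
the supremum takes finitely many values, each of which is approximated by one member. -/
theorem expectedSup_le_of_forall_finset [IsProbabilityMeasure P] {n : ℕ} {ε : Fin n → Ω → ℝ}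
    (hε : IsRademacherFamily P ε) {T : Set τ} (ψ : τ → Fin n → ℝ) {R : EReal} (hT : T.Nonempty)
    (h : ∀ (T₀ : Finset τ) (hT₀ : T₀.Nonempty), ↑T₀ ⊆ T →
      ((∫ ω, T₀.sup' hT₀ (fun t => ∑ i, ε i ω * ψ t i) ∂P : ℝ) : EReal) ≤ R) :
    expectedSup P T (fun t ω => ∑ i, ε i ω * ψ t i) ≤ R := by
  set Φ : (Fin n → ℤˣ) → EReal := fun σ => ⨆ t ∈ T, ((signSum (ψ t) σ : ℝ) : EReal) with hΦ
  -- One near-maximiser for each of the finitely many sign patterns yields a finite subclass whose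
  -- supremum exceeds `a` everywhere.
  have key : ∀ a : (Fin n → ℤˣ) → ℝ, (∀ σ, (a σ : EReal) < Φ σ) →
      ((𝔼 σ, a σ : ℝ) : EReal) ≤ R := by
    intro a ha
    have : ∀ σ, ∃ t ∈ T, a σ < signSum (ψ t) σ := fun σ => by
      obtain ⟨t, ht⟩ := lt_iSup_iff.1 (ha σ)
      obtain ⟨htT, ht⟩ := lt_iSup_iff.1 ht
      exact ⟨t, htT, EReal.coe_lt_coe_iff.1 ht⟩
    choose t ht hat using this
    classical
    have hne : (Finset.univ.image t).Nonempty := Finset.univ_nonempty.image t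
    refine le_trans (EReal.coe_le_coe_iff.2 ?_) (h (Finset.univ.image t) hne ?_)
    · rw [hε.integral_eq fun y => (Finset.univ.image t).sup' hne fun t => ∑ i, y i * ψ t i]
      refine Finset.expect_le_expect fun σ _ => (hat σ).le.trans ?_
      exact Finset.le_sup' (fun t => ∑ i, ((σ i : ℤ) : ℝ) * ψ t i)
        (Finset.mem_image_of_mem t (Finset.mem_univ σ))
    · rintro _ hs
      obtain ⟨σ, -, rfl⟩ := Finset.mem_image.1 (Finset.mem_coe.1 hs)
      exact ht σ
  obtain ⟨t₀, ht₀⟩ := hT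
  have hbot : ∀ σ, ((signSum (ψ t₀) σ : ℝ) : EReal) ≤ Φ σ := fun σ =>
    le_iSup₂ (f := fun t (_ : t ∈ T) => ((signSum (ψ t) σ : ℝ) : EReal)) t₀ ht₀
  by_cases htop : ∃ σ₀, Φ σ₀ = ⊤
  · obtain ⟨σ₀, hσ₀⟩ := htop
    suffices hR : R = ⊤ by rw [hR]; exact le_top
    rw [EReal.eq_top_iff_forall_lt]
    intro y
    classical
    set b : (Fin n → ℤˣ) → ℝ := fun σ => signSum (ψ t₀) σ - 1
    set c : ℝ := ((Fintype.card (Fin n → ℤˣ) : ℕ) : ℝ)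
    have hc : 0 < c := by simp only [c]; exact_mod_cast Fintype.card_pos
    -- This spike at `σ₀` makes the average of the test function equal to `y + 1`.
    set M : ℝ := c * (y + 1 - 𝔼 σ, b σ)
    refine lt_of_lt_of_le (EReal.coe_lt_coe_iff.2 ?_)
      (key (fun σ => b σ + if σ = σ₀ then M else 0) fun σ => ?_)
    · have hite : 𝔼 σ, (if σ = σ₀ then M else 0) = y + 1 - 𝔼 σ, b σ := by
        rw [Finset.expect_eq_sum_div_card, Finset.sum_ite_eq', if_pos (Finset.mem_univ _),
          Finset.card_univ]
        exact mul_div_cancel_left₀ _ hc.ne'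
      rw [Finset.expect_add_distrib, hite]
      linarith
    · by_cases hσ : σ = σ₀
      · rw [hσ, hσ₀]; exact EReal.coe_lt_top _
      · refine lt_of_lt_of_le (EReal.coe_lt_coe_iff.2 ?_) (hbot σ)
        simp [hσ, b]
  · push Not at htop
    have hreal : ∀ σ, (((Φ σ).toReal : ℝ) : EReal) = Φ σ := fun σ =>
      EReal.coe_toReal (htop σ) (ne_bot_of_le_ne_bot (EReal.coe_ne_bot _) (hbot σ))
    set G : (Fin n → ℝ) → ℝ := fun y => (⨆ t ∈ T, ((∑ i, y i * ψ t i : ℝ) : EReal)).toReal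
    have hG : ∀ σ : Fin n → ℤˣ, G (fun i => ((σ i : ℤ) : ℝ)) = (Φ σ).toReal := fun σ => rfl
    rw [expectedSup, extExpectation_eq_coe_integral (hε.integrable G), hε.integral_eq G]
    · simp only [hG]
      refine EReal.ge_of_forall_gt_iff_ge.1 fun z hz => ?_
      have hz' := EReal.coe_lt_coe_iff.1 hz
      refine (EReal.coe_le_coe_iff.2 (le_of_eq ?_)).trans
        (key (fun σ => (Φ σ).toReal - ((𝔼 σ, (Φ σ).toReal) - z)) fun σ => ?_)
      · rw [Finset.expect_sub_distrib, Fintype.expect_const]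
        ring
      · rw [← hreal σ]
        exact EReal.coe_lt_coe_iff.2 (by simp only [EReal.toReal_coe]; linarith)
    · filter_upwards [hε.ae_exists_sign] with ω ⟨σ, hσ⟩
      simp only [hσ]
      rw [hG, hreal]
      rfl

end ExpectedSup

/-! ### Convergence of Rademacher series. -/

section Series

variable {Ω : Type*} [MeasurableSpace Ω] {P : Measure Ω}

theorem eLpNorm_two_eq_ofReal_sqrt {f : Ω → ℝ} (hf : MemLp f 2 P) :
    eLpNorm f 2 P = ENNReal.ofReal √(∫ ω, f ω ^ 2 ∂P) := by
  rw [hf.eLpNorm_eq_integral_rpow_norm (by simp) (by simp), Real.sqrt_eq_rpow]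
  simp

namespace IsRademacherFamily

variable {ε : ℕ → Ω → ℝ}

theorem aemeasurable_sum_range (hε : IsRademacherFamily P ε) (a : ℕ → ℝ) (K : ℕ) :
    AEMeasurable (fun ω => ∑ k ∈ Finset.range K, ε k ω * a k) P :=
  Finset.aemeasurable_fun_sum _ fun k _ => (hε.hasLaw k).aemeasurable.mul_const _

variable [IsProbabilityMeasure P]

theorem memLp_two_sum_add (hε : IsRademacherFamily P ε) (a : ℕ → ℝ) (K m : ℕ) :
    MemLp (fun ω => ∑ j ∈ Finset.range m, ε (K + j) ω * a (K + j)) 2 P := by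
  have h := hε.comp_injective (g := fun j : Fin m => K + j)
    fun i j hij => Fin.ext (Nat.add_left_cancel hij)
  simp_rw [Finset.sum_range]
  rw [memLp_two_iff_integrable_sq
    (h.integrable fun y => ∑ j : Fin m, y j * a (K + j)).aestronglyMeasurable]
  exact h.integrable fun y => (∑ j : Fin m, y j * a (K + j)) ^ 2

theorem eLpNorm_sum_add (hε : IsRademacherFamily P ε) (a : ℕ → ℝ) (K m : ℕ) :
    eLpNorm (fun ω => ∑ j ∈ Finset.range m, ε (K + j) ω * a (K + j)) 2 P =
      ENNReal.ofReal √(∑ j ∈ Finset.range m, a (K + j) ^ 2) := by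
  have h := hε.comp_injective (g := fun j : Fin m => K + j)
    fun i j hij => Fin.ext (Nat.add_left_cancel hij)
  rw [eLpNorm_two_eq_ofReal_sqrt (hε.memLp_two_sum_add a K m)]
  simp_rw [Finset.sum_range]
  rw [h.integral_eq fun y => (∑ j : Fin m, y j * a (K + j)) ^ 2]
  congr 2
  exact expect_signSum_sq fun j : Fin m => a (K + j)

theorem integral_eq_zero (hε : IsRademacherFamily P ε) (k : ℕ) : ∫ ω, ε k ω ∂P = 0 := by
  have h := hε.comp_injective (g := fun _ : Fin 1 => k) fun i j _ => Subsingleton.elim i j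
  rw [h.integral_eq fun y => y 0, expect_cube_succ]
  simp

theorem integrable_single (hε : IsRademacherFamily P ε) (k : ℕ) : Integrable (ε k) P :=
  (hε.comp_injective (g := fun _ : Fin 1 => k)
    fun i j _ => Subsingleton.elim i j).integrable fun y => y 0

theorem martingale_sum (hε : IsRademacherFamily P ε) (hm : ∀ k, StronglyMeasurable (ε k))
    (a : ℕ → ℝ) :
    -- The natural filtration at time `K` already contains `ε K`, hence the range `K + 1`.
    Martingale (fun K ω => ∑ k ∈ Finset.range (K + 1), ε k ω * a k)
      (Filtration.natural ε hm) P := by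
  have hadp : StronglyAdapted (Filtration.natural ε hm)
      (fun K ω => ∑ k ∈ Finset.range (K + 1), ε k ω * a k) := fun K => by
    refine Finset.stronglyMeasurable_fun_sum _ fun k hk => ?_
    exact ((Filtration.stronglyAdapted_natural hm k).mono ((Filtration.natural ε hm).mono
      (Nat.lt_succ_iff.1 (Finset.mem_range.1 hk)))).mul_const _
  have hint : ∀ K, Integrable (fun ω => ∑ k ∈ Finset.range (K + 1), ε k ω * a k) P := fun K =>
    integrable_finsetSum _ fun k _ => (hε.integrable_single k).mul_const _
  refine martingale_nat hadp hint fun K => ?_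
  have hsucc : (fun ω => ∑ k ∈ Finset.range (K + 1 + 1), ε k ω * a k) =
      (fun ω => ∑ k ∈ Finset.range (K + 1), ε k ω * a k) + a (K + 1) • ε (K + 1) := by
    funext ω
    rw [Finset.sum_range_succ]
    simp [mul_comm]
  have h1 := condExp_add (hint K) ((hε.integrable_single (K + 1)).smul (a (K + 1)))
    (Filtration.natural ε hm K)
  have h2 := condExp_smul (μ := P) (a (K + 1)) (ε (K + 1)) (Filtration.natural ε hm K)
  have h3 := hε.indep.condExp_natural_ae_eq_of_lt hm (Nat.lt_succ_self K)
  have h4 := condExp_of_stronglyMeasurable ((Filtration.natural ε hm).le K) (hadp K) (hint K)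
  rw [hsucc]
  filter_upwards [h1, h2, h3] with ω w1 w2 w3
  rw [w1, Pi.add_apply, w2, h4, Pi.smul_apply, w3, hε.integral_eq_zero]
  simp

/-- Martingale convergence: the partial sums are bounded in `L²`, by orthogonality, hence in `L¹`.
-/
theorem exists_ae_tendsto_of_stronglyMeasurable (hε : IsRademacherFamily P ε)
    (hm : ∀ k, StronglyMeasurable (ε k)) {a : ℕ → ℝ} (ha : Summable fun k => a k ^ 2) :
    ∀ᵐ ω ∂P, ∃ c, Tendsto (fun K => ∑ k ∈ Finset.range K, ε k ω * a k) atTop (𝓝 c) := by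
  have h := (hε.martingale_sum hm a).submartingale.exists_ae_tendsto_of_bdd
    (R := Real.toNNReal √(∑' k, a k ^ 2)) fun K => by
      refine (eLpNorm_le_eLpNorm_of_exponent_le one_le_two
        (hε.aemeasurable_sum_range a (K + 1)).aestronglyMeasurable).trans ?_
      have := hε.eLpNorm_sum_add a 0 (K + 1)
      simp only [zero_add] at this
      rw [this]
      exact ENNReal.ofReal_le_ofReal (Real.sqrt_le_sqrt
        (ha.sum_le_tsum _ fun k _ => sq_nonneg _))
  filter_upwards [h] with ω ⟨c, hc⟩
  exact ⟨c, (tendsto_add_atTop_iff_nat 1).1 hc⟩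

theorem exists_ae_tendsto (hε : IsRademacherFamily P ε) {a : ℕ → ℝ}
    (ha : Summable fun k => a k ^ 2) :
    ∀ᵐ ω ∂P, ∃ c, Tendsto (fun K => ∑ k ∈ Finset.range K, ε k ω * a k) atTop (𝓝 c) := by
  have hae := fun k => (hε.hasLaw k).aemeasurable
  have hε' : IsRademacherFamily P fun k => (hae k).mk (ε k) :=
    ⟨fun k => (hε.hasLaw k).congr (hae k).ae_eq_mk.symm,
      (iIndepFun_congr fun k => (hae k).ae_eq_mk).1 hε.indep⟩
  filter_upwards [hε'.exists_ae_tendsto_of_stronglyMeasurable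
    (fun k => (hae k).measurable_mk.stronglyMeasurable) ha,
    ae_all_iff.2 fun k => (hae k).ae_eq_mk] with ω ⟨c, hc⟩ hω
  exact ⟨c, by simpa only [hω] using hc⟩

/-- A Rademacher series with square summable coefficients converges almost surely and in `L²`. -/
theorem exists_limit (hε : IsRademacherFamily P ε) {a : ℕ → ℝ} (ha : Summable fun k => a k ^ 2) :
    ∃ Y : Ω → ℝ, MemLp Y 2 P ∧
      (∀ᵐ ω ∂P, Tendsto (fun K => ∑ k ∈ Finset.range K, ε k ω * a k) atTop (𝓝 (Y ω))) ∧
      Tendsto (fun K => eLpNorm (fun ω => (∑ k ∈ Finset.range K, ε k ω * a k) - Y ω) 2 P)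
        atTop (𝓝 0) := by
  have hM := hε.aemeasurable_sum_range a
  obtain ⟨Y, hY, hlim⟩ := measurable_limit_of_tendsto_metrizable_ae hM (hε.exists_ae_tendsto ha)
  have hbound : ∀ K, eLpNorm (fun ω => (∑ k ∈ Finset.range K, ε k ω * a k) - Y ω) 2 P ≤
      ENNReal.ofReal √(∑' j, a (j + K) ^ 2) := by
    intro K
    rw [← eLpNorm_neg]
    have hsub : ∀ m ω, (∑ k ∈ Finset.range (m + K), ε k ω * a k) -
        (∑ k ∈ Finset.range K, ε k ω * a k) = ∑ j ∈ Finset.range m, ε (K + j) ω * a (K + j) :=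
      fun m ω => by rw [add_comm m K, Finset.sum_range_add, add_sub_cancel_left]
    -- Fatou's lemma bounds the tail of the series by the tail of `∑ a k ^ 2`.
    refine (Lp.eLpNorm_lim_le_liminf_eLpNorm
      (f := fun m ω => ∑ j ∈ Finset.range m, ε (K + j) ω * a (K + j))
      (fun m => (hε.memLp_two_sum_add a K m).1) _ ?_).trans ?_
    · filter_upwards [hlim] with ω hω
      simp only [Pi.neg_apply, neg_sub, ← hsub]
      exact ((tendsto_add_atTop_iff_nat K).2 hω).sub_const _
    · refine liminf_le_of_frequently_le' (Frequently.of_forall fun m => ?_)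
      rw [hε.eLpNorm_sum_add]
      refine ENNReal.ofReal_le_ofReal (Real.sqrt_le_sqrt ?_)
      simp only [add_comm K]
      exact ((summable_nat_add_iff K).2 ha).sum_le_tsum _ fun j _ => sq_nonneg _
  refine ⟨Y, ?_, hlim, ?_⟩
  · refine ⟨hY.aestronglyMeasurable, ?_⟩
    have h0 := hbound 0
    simp only [Finset.range_zero, Finset.sum_empty, zero_sub] at h0
    rw [← eLpNorm_neg]
    exact h0.trans_lt ENNReal.ofReal_lt_top
  · refine tendsto_of_tendsto_of_tendsto_of_le_of_le tendsto_const_nhds ?_ (fun _ => zero_le)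
      hbound
    have h := (_root_.tendsto_sum_nat_add fun k => a k ^ 2).sqrt
    rw [Real.sqrt_zero] at h
    simpa using ENNReal.tendsto_ofReal h

end IsRademacherFamily

theorem EllTwo.summable_sq (v : EllTwo) : Summable fun k => v k ^ 2 := by
  have h := (lp.memℓp v).summable (by simp)
  simpa using h

theorem exists_isRademacherSum [IsProbabilityMeasure P] {𝒳 : Type*} {n : ℕ} {ε : Fin n × ℕ → Ω → ℝ}
    (hε : IsRademacherFamily P ε) (x : Fin n → 𝒳) (f : 𝒳 → EllTwo) :
    ∃ Y : Ω → ℝ, MemLp Y 2 P ∧ IsRademacherSum P ε x f Y ∧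
      Tendsto (fun K => eLpNorm (fun ω => partialRademacherSum ε x f K ω - Y ω) 2 P)
        atTop (𝓝 0) := by
  have hrow : ∀ i, IsRademacherFamily P fun k => ε (i, k) := fun i =>
    hε.comp_injective (Prod.mk_right_injective i)
  choose Y hY hlim hL using fun i => (hrow i).exists_limit (EllTwo.summable_sq (f (x i)))
  refine ⟨fun ω => ∑ i, Y i ω, memLp_finsetSum _ fun i _ => hY i, ?_, ?_⟩
  · filter_upwards [ae_all_iff.2 hlim] with ω hω
    exact tendsto_finsetSum _ fun i _ => hω i
  · have h := tendsto_finsetSum Finset.univ fun i _ => hL i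
    rw [Finset.sum_const_zero] at h
    refine tendsto_of_tendsto_of_tendsto_of_le_of_le tendsto_const_nhds h (fun _ => zero_le)
      fun K => ?_
    have heq : (fun ω => partialRademacherSum ε x f K ω - ∑ i, Y i ω) =
        ∑ i, fun ω => (∑ k ∈ Finset.range K, ε (i, k) ω * f (x i) k) - Y i ω := by
      funext ω
      simp [partialRademacherSum, Finset.sum_apply]
    simp only [heq]
    exact eLpNorm_sum_le (fun i _ => (((hrow i).aemeasurable_sum_range _ K).aestronglyMeasurable).sub
      (hY i).1) one_le_two

end Series

/-! ### Contraction on a probability space and passage to `ℓ₂`. -/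

section Contraction

variable {Ω : Type*} [MeasurableSpace Ω] {P : Measure Ω}

/-- A finite maximum changes by at most the sum of the changes of its entries. -/
theorem tendsto_integral_sup' {τ : Type*} {T : Finset τ} (hT : T.Nonempty)
    {Z : ℕ → τ → Ω → ℝ} {Y : τ → Ω → ℝ} (hZ : ∀ K, ∀ t ∈ T, Integrable (Z K t) P)
    (hY : ∀ t ∈ T, Integrable (Y t) P)
    (h : ∀ t ∈ T, Tendsto (fun K => eLpNorm (fun ω => Z K t ω - Y t ω) 1 P) atTop (𝓝 0)) :
    Tendsto (fun K => ∫ ω, T.sup' hT (fun t => Z K t ω) ∂P) atTop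
      (𝓝 (∫ ω, T.sup' hT (fun t => Y t ω) ∂P)) := by
  refine tendsto_integral_of_L1' _ (integrable_sup' hT hY).aestronglyMeasurable
    (Eventually.of_forall fun K => integrable_sup' hT (hZ K)) ?_
  have hsum := tendsto_finsetSum T h
  rw [Finset.sum_const_zero] at hsum
  refine tendsto_of_tendsto_of_tendsto_of_le_of_le tendsto_const_nhds hsum (fun _ => zero_le)
    fun K => ?_
  refine le_trans ?_ (Finset.sum_le_sum fun t (_ : t ∈ T) =>
    (eLpNorm_norm (p := 1) (μ := P) fun ω => Z K t ω - Y t ω).le)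
  refine le_trans (eLpNorm_mono_real (g := ∑ t ∈ T, fun ω => ‖Z K t ω - Y t ω‖) fun ω => ?_)
    (eLpNorm_sum_le (fun t ht => ((hZ K t ht).sub (hY t ht)).norm.1) le_rfl)
  have hle : ∀ t ∈ T, ‖Z K t ω - Y t ω‖ ≤ ∑ t ∈ T, ‖Z K t ω - Y t ω‖ := fun t ht =>
    Finset.single_le_sum (f := fun t => ‖Z K t ω - Y t ω‖) (fun _ _ => norm_nonneg _) ht
  rw [Finset.sum_apply, Pi.sub_apply, Real.norm_eq_abs, abs_sub_le_iff]
  constructor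
  · rw [sub_le_iff_le_add, Finset.sup'_le_iff]
    intro t ht
    have h1 := (le_abs_self _).trans (hle t ht)
    have h2 := Finset.le_sup' (fun t => Y t ω) ht
    linarith
  · rw [sub_le_iff_le_add, Finset.sup'_le_iff]
    intro t ht
    have h1 := (neg_le_abs _).trans (hle t ht)
    have h2 := Finset.le_sup' (fun t => Z K t ω) ht
    linarith

variable [IsProbabilityMeasure P]

/-- The vector contraction inequality for finite classes. -/
theorem integral_sup'_rademacher_le {τ : Type*} {T : Finset τ} (hT : T.Nonempty) {n K : ℕ}
    {ε : Fin n → Ω → ℝ} (hε : IsRademacherFamily P ε)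
    {ε' : Fin n × Fin K → Ω → ℝ} (hε' : IsRademacherFamily P ε')
    {ψ : τ → Fin n → ℝ} {φ : τ → Fin n → Fin K → ℝ} {L : ℝ} (hL : 0 ≤ L)
    (h : ∀ i, ∀ s ∈ T, ∀ t ∈ T, |ψ s i - ψ t i| ≤ L * √(∑ k, (φ s i k - φ t i k) ^ 2)) :
    ∫ ω, T.sup' hT (fun t => ∑ i, ε i ω * ψ t i) ∂P ≤
      √2 * L * ∫ ω, T.sup' hT (fun t => ∑ i, ∑ k, ε' (i, k) ω * φ t i k) ∂P := by
  rw [hε.integral_eq fun y => T.sup' hT fun t => ∑ i, y i * ψ t i,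
    hε'.integral_eq fun y => T.sup' hT fun t => ∑ i, ∑ k, y (i, k) * φ t i k, Finset.mul_expect]
  -- Putting `L` into `φ` reduces to Lipschitz constant one and avoids dividing by `L`, which may
  -- vanish.
  have hcube := expect_sup'_sign_le hT (fun _ => 0) ψ (fun t i k => L * φ t i k)
    fun i s hs t ht => (h i s hs t ht).trans_eq <| by
      simp_rw [← mul_sub, mul_pow, ← Finset.mul_sum]
      rw [Real.sqrt_mul (sq_nonneg L), Real.sqrt_sq hL]
  simp only [zero_add] at hcube
  refine hcube.trans_eq ?_
  refine Fintype.expect_equiv (Equiv.curry (Fin n) (Fin K) ℤˣ).symm _ _ fun η => ?_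
  rw [Finset.mul₀_sup' (by positivity)]
  congr 1
  funext t
  simp only [signSum, Finset.mul_sum, Equiv.curry_symm_apply, Function.uncurry_apply_pair]
  exact Finset.sum_congr rfl fun i _ => Finset.sum_congr rfl fun k _ => by ring

theorem expectedSup_rademacher_le {𝒳 : Type*} {n : ℕ} (x : Fin n → 𝒳) (L : ℝ≥0)
    {ε : Fin n → Ω → ℝ} (hε : IsRademacherFamily P ε) {K : ℕ}
    (F : Set (𝒳 → EuclideanSpace ℝ (Fin K))) {h : Fin n → EuclideanSpace ℝ (Fin K) → ℝ}
    {ε' : Fin n × Fin K → Ω → ℝ} (hh : ∀ i, LipschitzWith L (h i))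
    (hε' : IsRademacherFamily P ε') :
    expectedSup P F (fun f ω => ∑ i, ε i ω * h i (f (x i))) ≤
      ((√2 * L : ℝ) : EReal) *
        expectedSup P F (fun f ω => ∑ i, ∑ k, ε' (i, k) ω * f (x i) k) := by
  rcases F.eq_empty_or_nonempty with rfl | hF
  · rw [expectedSup_empty]; exact bot_le
  have reduce := fun R => expectedSup_le_of_forall_finset (R := R) hε (T := F)
    (fun f i => h i (f (x i))) hF
  refine reduce _ fun T₀ hT₀ hsub => ?_
  have hint := hε'.integrable fun y => T₀.sup' hT₀ fun f => ∑ i, ∑ k, y (i, k) * f (x i) k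
  refine le_trans (EReal.coe_le_coe_iff.2 (integral_sup'_rademacher_le hT₀ hε hε'
    (φ := fun f i k => f (x i) k) L.coe_nonneg fun i s _ t _ => ?_)) ?_
  · have := (hh i).dist_le_mul (s (x i)) (t (x i))
    rwa [Real.dist_eq, EuclideanSpace.dist_eq, show (∑ k, dist (s (x i) k) (t (x i) k) ^ 2) =
      ∑ k, (s (x i) k - t (x i) k) ^ 2 from
        Finset.sum_congr rfl fun k _ => by rw [Real.dist_eq, sq_abs]] at this
  · rw [EReal.coe_mul]
    exact mul_le_mul_of_nonneg_left (coe_integral_sup'_le_expectedSup hT₀ hsub hint)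
      (EReal.coe_nonneg.2 (by positivity))

/-- The projection of `ℓ₂` onto the first `K` coordinates. -/
noncomputable def EllTwo.truncate (K : ℕ) (v : EllTwo) : EllTwo :=
  ∑ k ∈ Finset.range K, lp.single 2 k (v k)

theorem EllTwo.tendsto_truncate (v : EllTwo) :
    Tendsto (fun K => EllTwo.truncate K v) atTop (𝓝 v) :=
  (lp.hasSum_single (by simp) v).tendsto_sum_nat

theorem EllTwo.dist_truncate (K : ℕ) (v w : EllTwo) :
    dist (EllTwo.truncate K v) (EllTwo.truncate K w) =
      √(∑ k : Fin K, (v k - w k) ^ 2) := by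
  have h := lp.norm_sum_single (p := 2) (E := fun _ : ℕ => ℝ) (by simp) (fun k => v k - w k)
    (Finset.range K)
  have h' : truncate K v - truncate K w =
      ∑ k ∈ Finset.range K, lp.single 2 k (v k - w k) := by
    simp only [truncate, ← Finset.sum_sub_distrib, lp.single_sub]
  rw [dist_eq_norm, h', ← Finset.sum_range fun k => (v k - w k) ^ 2, eq_comm,
    Real.sqrt_eq_iff_eq_sq (Finset.sum_nonneg fun _ _ => sq_nonneg _) (norm_nonneg _)]
  simpa using h.symm

theorem tendsto_integral_sup'_sign {τ : Type*} {T : Finset τ} (hT : T.Nonempty) {n : ℕ}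
    {ε : Fin n → Ω → ℝ} (hε : IsRademacherFamily P ε) {ψ : ℕ → τ → Fin n → ℝ} {ψ' : τ → Fin n → ℝ}
    (h : ∀ t ∈ T, ∀ i, Tendsto (fun K => ψ K t i) atTop (𝓝 (ψ' t i))) :
    Tendsto (fun K => ∫ ω, T.sup' hT (fun t => ∑ i, ε i ω * ψ K t i) ∂P) atTop
      (𝓝 (∫ ω, T.sup' hT (fun t => ∑ i, ε i ω * ψ' t i) ∂P)) := by
  simp_rw [fun K => hε.integral_eq fun y => T.sup' hT fun t => ∑ i, y i * ψ K t i,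
    hε.integral_eq fun y => T.sup' hT fun t => ∑ i, y i * ψ' t i, Finset.expect_eq_sum_div_card]
  refine (tendsto_finsetSum _ fun σ _ => ?_).div_const _
  exact Tendsto.finset_sup'_nhds_apply hT fun t ht =>
    tendsto_finsetSum _ fun i _ => (h t ht i).const_mul _

theorem expectedSup_rademacher_ellTwo_le {𝒳 : Type*} {n : ℕ} (x : Fin n → 𝒳) (L : ℝ≥0)
    {ε : Fin n → Ω → ℝ} (hε : IsRademacherFamily P ε) (F : Set (𝒳 → EllTwo))
    {h : Fin n → EllTwo → ℝ} {ε' : Fin n × ℕ → Ω → ℝ} (hh : ∀ i, LipschitzWith L (h i))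
    (hε' : IsRademacherFamily P ε') {S : (𝒳 → EllTwo) → Ω → ℝ}
    (hS : ∀ f ∈ F, IsRademacherSum P ε' x f (S f)) :
    expectedSup P F (fun f ω => ∑ i, ε i ω * h i (f (x i))) ≤
      ((√2 * L : ℝ) : EReal) * expectedSup P F S := by
  rcases F.eq_empty_or_nonempty with rfl | hF
  · rw [expectedSup_empty]; exact bot_le
  have reduce := fun R => expectedSup_le_of_forall_finset (R := R) hε (T := F)
    (fun f i => h i (f (x i))) hF
  refine reduce _ fun T₀ hT₀ hsub => ?_
  have hε'K : ∀ K : ℕ, IsRademacherFamily P fun p : Fin n × Fin K => ε' (p.1, p.2) := fun K =>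
    hε'.comp_injective (g := fun p : Fin n × Fin K => (p.1, (p.2 : ℕ)))
      (Function.injective_id.prodMap Fin.val_injective)
  have hsum : ∀ f K, partialRademacherSum ε' x f K =
      fun ω => ∑ i, ∑ k : Fin K, ε' (i, k) ω * f (x i) k := fun f K => by
    funext ω
    simp only [partialRademacherSum, Finset.sum_range]
  have hintM : ∀ f K, Integrable (partialRademacherSum ε' x f K) P := fun f K => by
    rw [hsum]
    exact (hε'K K).integrable fun y => ∑ i, ∑ k, y (i, k) * f (x i) k
  have hSint : ∀ f ∈ F, Integrable (S f) P ∧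
      Tendsto (fun K => eLpNorm (fun ω => partialRademacherSum ε' x f K ω - S f ω) 1 P)
        atTop (𝓝 0) := by
    intro f hf
    obtain ⟨Y, hY, hYlim, hYL⟩ := exists_isRademacherSum hε' x f
    -- Almost sure limits are unique, so any chosen version inherits integrability and `L¹`
    -- convergence from the `L²` limit.
    have hYS : Y =ᵐ[P] S f := by
      filter_upwards [hYlim, hS f hf] with ω h1 h2
      exact tendsto_nhds_unique h1 h2
    refine ⟨(hY.integrable one_le_two).congr hYS, ?_⟩
    refine tendsto_of_tendsto_of_tendsto_of_le_of_le tendsto_const_nhds hYL (fun _ => zero_le)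
      fun K => ?_
    refine (eLpNorm_congr_ae ?_).trans_le (eLpNorm_le_eLpNorm_of_exponent_le one_le_two
      ((hintM f K).1.sub hY.1))
    filter_upwards [hYS] with ω hω
    simp [hω]
  have hint : Integrable (fun ω => T₀.sup' hT₀ fun f => S f ω) P :=
    integrable_sup' hT₀ fun f hf => (hSint f (hsub hf)).1
  have hlim_right := (tendsto_integral_sup' hT₀ (Z := fun K f => partialRademacherSum ε' x f K)
    (fun K f _ => hintM f K) (fun f hf => (hSint f (hsub hf)).1)
    fun f hf => (hSint f (hsub hf)).2).const_mul (√2 * L : ℝ)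
  -- Truncating inside `h i` gives functions that are Lipschitz in the first `K` coordinates;
  -- continuity of `h i` recovers the original left side.
  have hlim_left := tendsto_integral_sup'_sign hT₀ hε
    (ψ := fun K f i => h i (EllTwo.truncate K (f (x i)))) (ψ' := fun f i => h i (f (x i)))
    fun f _ i => ((hh i).continuous.tendsto _).comp (EllTwo.tendsto_truncate (f (x i)))
  have hfin := le_of_tendsto_of_tendsto' hlim_left hlim_right fun K => by
    simp only [hsum]
    refine integral_sup'_rademacher_le hT₀ hε (hε'K K) (φ := fun f i k => f (x i) k)
      L.coe_nonneg fun i s _ t _ => ?_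
    rw [← Real.dist_eq, ← EllTwo.dist_truncate]
    exact (hh i).dist_le_mul _ _
  refine (EReal.coe_le_coe_iff.2 hfin).trans ?_
  rw [EReal.coe_mul]
  exact mul_le_mul_of_nonneg_left (coe_integral_sup'_le_expectedSup hT₀ hsub hint)
    (EReal.coe_nonneg.2 (by positivity))

end Contraction

theorem corollary3 {Ω 𝒳 : Type*} [MeasurableSpace Ω] (P : Measure Ω) [IsProbabilityMeasure P]
    (n : ℕ) (x : Fin n → 𝒳) (L : ℝ≥0)
    (ε : Fin n → Ω → ℝ) (hε : IsRademacherFamily P ε) :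
    -- functions with values in `ℓ₂`
    (∀ (F : Set (𝒳 → EllTwo)) (h : Fin n → EllTwo → ℝ) (ε' : Fin n × ℕ → Ω → ℝ),
      (∀ i, LipschitzWith L (h i)) → IsRademacherFamily P ε' →
      -- every series on the right converges, almost surely and in `L²`
      (∀ f ∈ F, ∃ Y : Ω → ℝ, MemLp Y 2 P ∧ IsRademacherSum P ε' x f Y ∧
        Tendsto (fun K => eLpNorm (fun ω => partialRademacherSum ε' x f K ω - Y ω) 2 P)
          atTop (𝓝 0)) ∧
      -- the inequality, whichever versions `S f` of the sums of the series are chosen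
      (∀ S : (𝒳 → EllTwo) → Ω → ℝ, (∀ f ∈ F, IsRademacherSum P ε' x f (S f)) →
        expectedSup P F (fun f ω => ∑ i, ε i ω * h i (f (x i))) ≤
          ((√2 * L : ℝ) : EReal) * expectedSup P F S)) ∧
    -- functions with values in `ℝ^K`
    (∀ (K : ℕ) (F : Set (𝒳 → EuclideanSpace ℝ (Fin K)))
      (h : Fin n → EuclideanSpace ℝ (Fin K) → ℝ) (ε' : Fin n × Fin K → Ω → ℝ),
      (∀ i, LipschitzWith L (h i)) → IsRademacherFamily P ε' →
      expectedSup P F (fun f ω => ∑ i, ε i ω * h i (f (x i))) ≤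
        ((√2 * L : ℝ) : EReal) *
          expectedSup P F (fun f ω => ∑ i, ∑ k, ε' (i, k) ω * f (x i) k)) := by
  exact ⟨fun F _ _ hh hε' =>
      ⟨fun f _ => exists_isRademacherSum hε' x f,
        fun _ hS => expectedSup_rademacher_ellTwo_le x L hε F hh hε' hS⟩,
    fun _ F _ _ hh hε' => expectedSup_rademacher_le x L hε F hh hε'⟩
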